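/- \textbf{Setting.} Let $A$ be an affine space over a real vector space $L$ (of any, in particular infinite, dimension), with a symplectic potential $\theta:A\times L\to\mathbb{R}$, linear in the second argument, and a bilinear form $[\cdot,\cdot]:L\times L\to\mathbb{R}$ such that $\theta(\eta+\xi,\tau)=\theta(\eta,\tau)+[\xi,\tau]$, and such that the symplectic form $\omega(\xi,\tau)=\frac12[\xi,\tau]-\frac12[\tau,\xi]$ is non-degenerate. Put $M=\{\tau\in L:[\xi,\tau]=0\ \forall\xi\in L\}$ and $N=\{\tau\in L:[\tau,\xi]=0\ \forall\xi\in L\}$. Assume that $M+N=L$ and that $\theta$ is adapted to the polarization $M$, i.e. $\theta(\eta,\tau)=0$ for all $\eta\in A$, $\tau\in M$. Let $q:L\to Q=L/M$ and $c:A\to C=A/M$ be the quotient maps; $[\cdot,\cdot]$ and $\theta$ are viewed also as maps $L\times Q\to\mathbb{R}$ and $A\times Q\to\mathbb{R}$. Let $\Omega:Q\times Q\to\mathbb{C}$ be an admissible form: $\Omega$ is symmetric and real bilinear, $\Re\,\Omega$ is positive definite and makes $Q$ a separable real Hilbert space, $\Im\,\Omega$ is continuous on this Hilbert space, and the continuous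 linear functionals on $Q$ are exactly the maps $\phi\mapsto[\xi,\phi]$ with $\xi\in L$. Let $\hat Q$ be the algebraic dual of the topological dual of $Q$, with the $\sigma$-algebra generated by the cylinder sets, and let $\nu_Q$ be the Gaussian probability measure on $\hat Q$ that is the projective limit of the normalized Gaussian measures proportional to $e^{-\Re\,\Omega(\phi,\phi)}\,d\phi$ on the finite-dimensional quotients of $Q$ by closed subspaces (with the quotient inner product). For $\eta\in A$ the affine coherent state $\hat K_\eta$ has the Schr\"odinger wave function $$\hat K^{\mathrm S}_\eta(\varphi)=\exp\Big(\mathrm{i}\,\theta(\eta,\varphi-c(\eta))-\tfrac12\Omega(\varphi-c(\eta),\varphi-c(\eta))\Big),\qquad \varphi\in C.$$ Given a base point $\eta'\in A$, the Schr\"odinger Hilbert space $\mathcal{H}^{\tilde S}$ is presented as $L^2(\hat Q,\nu_Q)$ by means of $\eta'$-reduced wave functions, and $\hat K_\eta$ is presented by the canonical extension to $\hat Q$ of $$\beta_{\eta,\eta'}(\phi)=\frac{\hat K^{\mathrm S}_\eta(\phi+c(\eta'))}{\hat K^{\mathrm S}_{\eta'}(\phi+c(\eta'))}=\exp\Big(\mathrm{i}\,\theta(\eta,\eta'-\eta)-\tfrac12\Omega(q(\eta'-\eta),q(\eta'-\eta))-\mathrm{i}[\eta'-\eta,\phi]-\Omega(q(\eta'-\eta),\phi)\Big),\qquad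 \phi\in Q.$$ \textbf{Proposition.} For every base point $\eta'\in A$, the functions $\beta_{\eta,\eta'}$, $\eta\in A$, are square-integrable on $(\hat Q,\nu_Q)$, and their complex linear span $\mathcal{H}^{\tilde S,c}$ is dense in $\mathcal{H}^{\tilde S}=L^2(\hat Q,\nu_Q)$. -/

import Mathlib

open MeasureTheory ProbabilityTheory

noncomputable section

namespace SchrodingerRep

/-! ## The algebraic extension of a Hilbert space and its Gaussian measure -/

section GaussianExtension

variable {E : Type*} [NormedAddCommGroup E] [InnerProductSpace ℝ E]

variable (E) in
/-- The extension of a real Hilbert space `E`: the algebraic dual of its topological dual. -/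
abbrev AlgExt : Type _ := StrongDual ℝ E →ₗ[ℝ] ℝ

/-- The `σ`-algebra generated by the cylinder sets, i.e. the smallest one for which all the linear
coordinates `x ↦ x l` are measurable. -/
instance : MeasurableSpace (AlgExt E) :=
  MeasurableSpace.comap (fun (x : AlgExt E) (l : StrongDual ℝ E) => x l) MeasurableSpace.pi

/-- The canonical inclusion of `E` into its extension. -/
def AlgExt.incl (v : E) : AlgExt E where
  toFun l := l v
  map_add' _ _ := rfl
  map_smul' _ _ := rfl

/-- `ν` is the projective limit of the centred Gaussian measures `exp (-‖v‖ ^ 2) dv` (normalized to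
be probability measures) on the finite-dimensional quotients of `E`. Such a quotient is identified
isometrically with `ℝⁿ` by an orthonormal basis `e` of the orthogonal complement of the subspace
divided out, and the projection of the extension onto it is `x ↦ (x ⟪e i, ·⟫)ᵢ`. Recall that
`gaussianReal 0 (1 / 2)` has the density `exp (-t ^ 2) / √π`. -/
def IsGaussianLimit (ν : Measure (AlgExt E)) : Prop :=
  ∀ (n : ℕ) (e : Fin n → E), Orthonormal ℝ e →
    ν.map (fun (x : AlgExt E) (i : Fin n) => x (innerSL ℝ (e i))) =
      Measure.pi (fun _ : Fin n => gaussianReal 0 (1 / 2))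

lemma measurable_algExt_apply (l : StrongDual ℝ E) : Measurable (fun x : AlgExt E => x l) :=
  (measurable_pi_apply l).comp (comap_measurable _)

lemma isGaussianLimit_of_charFun {ν : Measure (AlgExt E)} [IsProbabilityMeasure ν]
    (h : ∀ v : E, ∫ x, Complex.exp (((x (innerSL ℝ v) : ℝ) : ℂ) * Complex.I) ∂ν =
      Complex.exp (-((‖v‖ ^ 2 / 4 : ℝ) : ℂ))) : IsGaussianLimit ν := by
  classical
  intro n e he
  have hm : Measurable (fun (x : AlgExt E) (i : Fin n) => x (innerSL ℝ (e i))) :=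
    measurable_pi_lambda _ fun i => measurable_algExt_apply _
  have : IsProbabilityMeasure
      (ν.map (fun (x : AlgExt E) (i : Fin n) => x (innerSL ℝ (e i)))) :=
    Measure.isProbabilityMeasure_map hm.aemeasurable
  refine Measure.ext_of_charFunDual ?_
  ext l
  have hl : ∀ t : Fin n → ℝ, l t = ∑ i, l (Pi.single i 1) * t i := by
    intro t
    conv_lhs => rw [← Finset.univ_sum_single t]
    rw [map_sum]
    refine Finset.sum_congr rfl fun i _ => ?_
    have : (Pi.single i (t i) : Fin n → ℝ) = t i • Pi.single i 1 := by
      rw [← Pi.single_smul]; simp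
    rw [this, map_smul, smul_eq_mul, mul_comm]
  rw [charFunDual_apply, integral_map hm.aemeasurable (by fun_prop), charFunDual_pi]
  have key : ∀ x : AlgExt E, l (fun i => x (innerSL ℝ (e i))) =
      x (innerSL ℝ (∑ i, l (Pi.single i 1) • e i)) := by
    intro x
    rw [hl]
    simp [map_sum]
  simp_rw [key]
  rw [h]
  have hn : ‖∑ i, l (Pi.single i 1) • e i‖ ^ 2 = ∑ i, l (Pi.single i 1) ^ 2 := by
    rw [← real_inner_self_eq_norm_sq, he.inner_sum]
    simp [sq]
  rw [hn]
  have : ∀ i : Fin n, charFunDual (gaussianReal 0 (1 / 2))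
      (l.comp (ContinuousLinearMap.single ℝ (fun _ : Fin n => ℝ) i)) =
      Complex.exp (-((l (Pi.single i 1) ^ 2 / 4 : ℝ) : ℂ)) := by
    intro i
    have h1 := charFun_gaussianReal (μ := 0) (v := 1 / 2) (l (Pi.single i 1))
    rw [charFun_apply_real] at h1
    rw [charFunDual_apply]
    have : ∀ t : ℝ, (l.comp (ContinuousLinearMap.single ℝ (fun _ : Fin n => ℝ) i)) t =
        l (Pi.single i 1) * t := by
      intro t
      rw [ContinuousLinearMap.comp_apply, hl, Finset.sum_eq_single i] <;> simp +contextual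
    simp_rw [this]
    push_cast at h1 ⊢
    rw [h1]
    congr 1
    ring
  simp_rw [this]
  rw [← Complex.exp_sum]
  congr 1
  push_cast
  rw [Finset.sum_div, ← Finset.sum_neg_distrib]

lemma IsGaussianLimit.isProbabilityMeasure {ν : Measure (AlgExt E)} (h : IsGaussianLimit ν) :
    IsProbabilityMeasure ν := by
  have h0 := h 0 Fin.elim0 ⟨fun i => i.elim0, fun i => i.elim0⟩
  have hm : Measurable (fun (x : AlgExt E) (i : Fin 0) => x (innerSL ℝ (Fin.elim0 i : E))) :=
    measurable_pi_lambda _ fun i => i.elim0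
  constructor
  have := congrArg (fun m => m Set.univ) h0
  simp only [Measure.map_apply hm MeasurableSet.univ, Set.preimage_univ, measure_univ] at this
  exact this

lemma IsGaussianLimit.charFun {ν : Measure (AlgExt E)} (h : IsGaussianLimit ν) (v : E) :
    ∫ x, Complex.exp (((x (innerSL ℝ v) : ℝ) : ℂ) * Complex.I) ∂ν =
      Complex.exp (-((‖v‖ ^ 2 / 4 : ℝ) : ℂ)) := by
  have := h.isProbabilityMeasure
  rcases eq_or_ne v 0 with rfl | hv
  · simp
  have hv' : ‖v‖ ≠ 0 := norm_ne_zero_iff.2 hv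
  have ho : Orthonormal ℝ (fun _ : Fin 1 => ‖v‖⁻¹ • v) := by
    refine ⟨fun _ => ?_, fun i j hij => (hij (Subsingleton.elim i j)).elim⟩
    rw [norm_smul, norm_inv, norm_norm, inv_mul_cancel₀ hv']
  have h1 := h 1 _ ho
  have hm : Measurable (fun (x : AlgExt E) (_ : Fin 1) => x (innerSL ℝ (‖v‖⁻¹ • v))) :=
    measurable_pi_lambda _ fun i => measurable_algExt_apply _
  have h2 : ν.map (fun x : AlgExt E => x (innerSL ℝ (‖v‖⁻¹ • v))) = gaussianReal 0 (1 / 2) := by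
    have h3 := congrArg (fun m : Measure (Fin 1 → ℝ) => m.map (fun t => t 0)) h1
    rw [Measure.map_map (measurable_pi_apply _) hm] at h3
    rw [(measurePreserving_eval (fun _ : Fin 1 => gaussianReal 0 (1 / 2)) 0).map_eq] at h3
    exact h3
  have h4 := charFun_gaussianReal (μ := 0) (v := 1 / 2) ‖v‖
  rw [← h2, charFun_apply_real, integral_map (measurable_algExt_apply _).aemeasurable
    (by fun_prop)] at h4
  have h5 : ∀ x : AlgExt E, ((x (innerSL ℝ v) : ℝ) : ℂ) =
      (‖v‖ : ℂ) * ((x (innerSL ℝ (‖v‖⁻¹ • v)) : ℝ) : ℂ) := by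
    intro x
    rw [map_smul, map_smul, smul_eq_mul]
    push_cast
    rw [← mul_assoc, mul_inv_cancel₀ (by exact_mod_cast hv'), one_mul]
  simp_rw [h5]
  rw [h4]
  congr 1
  push_cast
  ring

lemma IsGaussianLimit.unique [CompleteSpace E] {ν ν' : Measure (AlgExt E)}
    (h : IsGaussianLimit ν) (h' : IsGaussianLimit ν') : ν = ν' := by
  classical
  have := h.isProbabilityMeasure
  have := h'.isProbabilityMeasure
  set c : AlgExt E → StrongDual ℝ E → ℝ := fun x l => x l with hc
  have hcm : Measurable c := comap_measurable _
  have hcP : ∀ (μ : Measure (AlgExt E)) (J : Finset (StrongDual ℝ E)),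
      (μ.map c).map J.restrict = μ.map (fun x (j : J) => x j) := by
    intro μ J
    rw [Measure.map_map (by fun_prop) hcm]
    rfl
  have hlim : ν.map c = ν'.map c := by
    have := Measure.isProbabilityMeasure_map (μ := ν) hcm.aemeasurable
    have := Measure.isProbabilityMeasure_map (μ := ν') hcm.aemeasurable
    refine IsProjectiveLimit.unique (P := fun J => (ν'.map c).map J.restrict) (fun J => ?_)
      (fun J => rfl)
    have hJm : Measurable (fun (x : AlgExt E) (j : J) => x (j : StrongDual ℝ E)) :=
      measurable_pi_lambda _ fun i => measurable_algExt_apply _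
    rw [hcP ν]
    refine Eq.trans ?_ (hcP ν' J).symm
    have := Measure.isProbabilityMeasure_map (μ := ν) hJm.aemeasurable
    have := Measure.isProbabilityMeasure_map (μ := ν') hJm.aemeasurable
    refine Measure.ext_of_charFunDual ?_
    ext L
    rw [charFunDual_apply, charFunDual_apply, integral_map hJm.aemeasurable (by fun_prop),
      integral_map hJm.aemeasurable (by fun_prop)]
    have key : ∀ x : AlgExt E, L (fun j : J => x (j : StrongDual ℝ E)) =
        x (innerSL ℝ ((InnerProductSpace.toDual ℝ E).symm
          (∑ j : J, L (Pi.single j 1) • (j : StrongDual ℝ E)))) := by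
      intro x
      have : innerSL ℝ ((InnerProductSpace.toDual ℝ E).symm
          (∑ j : J, L (Pi.single j 1) • (j : StrongDual ℝ E))) =
          ∑ j : J, L (Pi.single j 1) • (j : StrongDual ℝ E) :=
        (InnerProductSpace.toDual ℝ E).apply_symm_apply _
      rw [this, map_sum]
      conv_lhs => rw [← Finset.univ_sum_single (fun j : J => x (j : StrongDual ℝ E))]
      rw [map_sum]
      refine Finset.sum_congr rfl fun i _ => ?_
      have : (Pi.single i (x i) : J → ℝ) = x i • Pi.single i 1 := by
        rw [← Pi.single_smul]; simp
      rw [this, map_smul, map_smul, smul_eq_mul, smul_eq_mul, mul_comm]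
    simp_rw [key]
    rw [h.charFun, h'.charFun]
  ext s hs
  obtain ⟨t, ht, rfl⟩ := hs
  have := congrArg (fun m => m t) hlim
  simpa only [Measure.map_apply hcm ht] using this

lemma integral_exp_linearCombination {ι : Type*} (a : ι →₀ ℝ) :
    ∫ ω, Complex.exp (((a.sum fun i r => r * ω i : ℝ) : ℂ) * Complex.I)
      ∂(Measure.infinitePi fun _ : ι => gaussianReal 0 1) =
      Complex.exp (-((a.sum fun _ r => r ^ 2 / 2 : ℝ) : ℂ)) := by
  classical
  set P := Measure.infinitePi fun _ : ι => gaussianReal 0 1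
  have hind : iIndepFun (fun (i : a.support) (ω : ι → ℝ) => a i * ω i) P :=
    (iIndepFun_infinitePi (P := fun _ : ι => gaussianReal 0 1)
      (X := fun i (t : ℝ) => a i * t) (by fun_prop)).precomp Subtype.val_injective
  have hm : ∀ (r : ℝ) (i : ι), Measurable fun ω : ι → ℝ => r * ω i := fun r i => by
    fun_prop
  have h1 := hind.charFun_map_fun_sum_eq_prod (fun i => (hm _ _).aemeasurable)
  have h2 := congrFun h1 1
  rw [charFun_apply_real, integral_map
    (Finset.measurable_sum _ fun i _ => hm _ _).aemeasurable (by fun_prop)] at h2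
  rw [Finset.prod_apply] at h2
  have h3 : ∀ i : a.support, charFun (P.map fun ω => a i * ω i) 1 =
      Complex.exp (-((a i ^ 2 / 2 : ℝ) : ℂ)) := by
    intro i
    have h4 := charFun_gaussianReal (μ := 0) (v := 1) (a i)
    rw [charFun_apply_real] at h4
    rw [charFun_apply_real, integral_map (hm _ _).aemeasurable (by fun_prop)]
    have h5 : P.map (fun ω => ω (i : ι)) = gaussianReal 0 1 := Measure.infinitePi_map_eval _ _
    rw [← h5, integral_map (measurable_pi_apply _).aemeasurable (by fun_prop)] at h4
    simp only [Complex.ofReal_one, one_mul, Complex.ofReal_mul]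
    rw [h4]
    congr 1
    push_cast
    ring
  simp_rw [h3] at h2
  rw [← Complex.exp_sum] at h2
  have e1 : ∀ ω : ι → ℝ, (a.sum fun i r => r * ω i) = ∑ i : a.support, a i * ω i := by
    intro ω
    rw [Finsupp.sum, ← Finset.sum_coe_sort]
  have e2 : (a.sum fun _ r => r ^ 2 / 2) = ∑ i : a.support, a i ^ 2 / 2 := by
    rw [Finsupp.sum, ← Finset.sum_coe_sort]
  simp_rw [e1, e2]
  simp only [Complex.ofReal_one, one_mul] at h2
  rw [h2, Finset.sum_neg_distrib]
  push_cast
  rfl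

universe u

lemma exists_isonormal (E : Type u) [NormedAddCommGroup E] [InnerProductSpace ℝ E]
    [CompleteSpace E] :
    ∃ (Ω : Type u) (_ : MeasurableSpace Ω) (P : Measure Ω) (_ : IsProbabilityMeasure P)
      (W : E →ₗ[ℝ] Lp ℝ 2 P),
      ∀ v : E, ∫ ω, Complex.exp (((W v ω : ℝ) : ℂ) * Complex.I) ∂P =
        Complex.exp (-((‖v‖ ^ 2 / 2 : ℝ) : ℂ)) := by
  classical
  obtain ⟨ι, b, -⟩ := exists_hilbertBasis ℝ E
  set P : Measure (ι → ℝ) := Measure.infinitePi fun _ : ι => gaussianReal 0 1 with hP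
  have hlaw : ∀ i : ι, P.map (fun ω => ω i) = gaussianReal 0 1 :=
    fun i => Measure.infinitePi_map_eval _ _
  have hmp : ∀ i : ι, MeasurePreserving (fun ω : ι → ℝ => ω i) P (gaussianReal 0 1) :=
    fun i => ⟨by fun_prop, hlaw i⟩
  have hmem : ∀ i : ι, MemLp (fun ω : ι → ℝ => ω i) 2 P := fun i =>
    (IsGaussian.memLp_two_id (μ := gaussianReal 0 1)).comp_measurePreserving (hmp i)
  set X : ι → Lp ℝ 2 P := fun i => (hmem i).toLp _ with hX
  have hXae : ∀ i, X i =ᵐ[P] fun ω => ω i := fun i => (hmem i).coeFn_toLp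
  have hXo : Orthonormal ℝ X := by
    rw [orthonormal_iff_ite]
    intro i j
    have e : inner ℝ (X i) (X j) = ∫ ω, ω i * ω j ∂P := by
      rw [L2.inner_def]
      refine integral_congr_ae ?_
      filter_upwards [hXae i, hXae j] with ω hi hj
      rw [hi, hj, real_inner_eq_re_inner]
      simp [mul_comm]
    rw [e]
    have hmean : ∀ i, ∫ ω, ω i ∂P = 0 := by
      intro i
      have := integral_map (μ := P) (φ := fun ω => ω i) (f := fun t : ℝ => t)
        (measurable_pi_apply _).aemeasurable (by fun_prop)
      rw [← this, hlaw, integral_id_gaussianReal]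
    split_ifs with hij
    · subst hij
      have h1 := variance_fun_id_gaussianReal (μ := 0) (v := 1)
      rw [variance_eq_integral (by fun_prop), integral_id_gaussianReal, ← hlaw i,
        integral_map (measurable_pi_apply _).aemeasurable (by fun_prop)] at h1
      simpa [sq] using h1
    · have hind := (iIndepFun_infinitePi (P := fun _ : ι => gaussianReal 0 1)
        (X := fun i (t : ℝ) => t) (by fun_prop)).indepFun hij
      have := hind.integral_fun_mul_eq_mul_integral
        (measurable_pi_apply _).aestronglyMeasurable (measurable_pi_apply _).aestronglyMeasurable
      rw [this, hmean, zero_mul]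
  obtain ⟨W, hWb⟩ : ∃ W : E →ₗᵢ[ℝ] Lp ℝ 2 P, ∀ i, W (b i) = X i := by
    refine ⟨hXo.orthogonalFamily.linearIsometry.comp b.repr.toLinearIsometry, fun i => ?_⟩
    have h1 : b.repr (b i) = lp.single 2 i (1 : ℝ) := b.repr_self i
    have h2 := hXo.orthogonalFamily.linearIsometry_apply_single (i := i) (1 : ℝ)
    rw [← h1] at h2
    refine h2.trans ?_
    simp
  refine ⟨ι → ℝ, inferInstance, P, inferInstance, W.toLinearMap, ?_⟩
  -- both sides are continuous in the vector, so it suffices to treat finite combinations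
  have hcont : Continuous fun v : E =>
      ∫ ω, Complex.exp (((W v ω : ℝ) : ℂ) * Complex.I) ∂P := by
    have hint : ∀ v, Integrable (fun ω => Complex.exp (((W v ω : ℝ) : ℂ) * Complex.I)) P := by
      intro v
      refine Integrable.of_bound (C := 1) ?_ (ae_of_all _ fun ω => ?_)
      · exact (by fun_prop : Continuous fun t : ℝ =>
          Complex.exp ((t : ℂ) * Complex.I)).comp_aestronglyMeasurable
            (Lp.aestronglyMeasurable (W v))
      · rw [Complex.norm_exp_ofReal_mul_I]
    refine LipschitzWith.continuous (K := 1) (LipschitzWith.of_dist_le_mul fun v w => ?_)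
    rw [dist_eq_norm, ← integral_sub (hint v) (hint w), NNReal.coe_one, one_mul]
    have hsub : ∀ᵐ ω ∂P, W (v - w) ω = W v ω - W w ω := by
      rw [map_sub]; exact Lp.coeFn_sub _ _
    have hb : ∀ᵐ ω ∂P, ‖Complex.exp (((W v ω : ℝ) : ℂ) * Complex.I) -
        Complex.exp (((W w ω : ℝ) : ℂ) * Complex.I)‖ ≤ ‖W (v - w) ω‖ := by
      filter_upwards [hsub] with ω h
      have : Complex.exp (((W v ω : ℝ) : ℂ) * Complex.I) -
        Complex.exp (((W w ω : ℝ) : ℂ) * Complex.I) =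
        Complex.exp (((W w ω : ℝ) : ℂ) * Complex.I) *
          (Complex.exp (Complex.I * ((W v ω - W w ω : ℝ) : ℂ)) - 1) := by
        rw [mul_sub, ← Complex.exp_add, mul_one]
        congr 2
        push_cast
        ring
      rw [this, norm_mul, Complex.norm_exp_ofReal_mul_I, one_mul, h]
      exact Real.norm_exp_I_mul_ofReal_sub_one_le
    have hL1 : Integrable (fun ω => ‖W (v - w) ω‖) P :=
      ((Lp.memLp (W (v - w))).integrable (by norm_num)).norm
    refine (norm_integral_le_of_norm_le hL1 hb).trans ?_
    have h1 : ∫ ω, ‖W (v - w) ω‖ ∂P = (eLpNorm (W (v - w)) 1 P).toReal := by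
      rw [integral_norm_eq_lintegral_enorm (Lp.aestronglyMeasurable _),
        eLpNorm_one_eq_lintegral_enorm]
    rw [h1, dist_eq_norm, ← W.norm_map (v - w), Lp.norm_def]
    refine ENNReal.toReal_mono (Lp.eLpNorm_ne_top _) ?_
    exact eLpNorm_le_eLpNorm_of_exponent_le (by norm_num) (Lp.aestronglyMeasurable _)
  have hcont' : Continuous fun v : E => Complex.exp (-((‖v‖ ^ 2 / 2 : ℝ) : ℂ)) := by fun_prop
  have hden : Dense (Submodule.span ℝ (Set.range b) : Set E) := by
    have := b.dense_span
    rwa [← Submodule.dense_iff_topologicalClosure_eq_top] at this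
  refine fun v => congrFun (Continuous.ext_on hden hcont hcont' ?_) v
  intro v hv
  obtain ⟨a, rfl⟩ := Finsupp.mem_span_range_iff_exists_finsupp.1 hv
  have hae : ∀ᵐ ω ∂P, W (a.sum fun i r => r • b i) ω = a.sum fun i r => r * ω i := by
    have h1 : W (a.sum fun i r => r • b i) = ∑ i ∈ a.support, a i • X i := by
      simp [Finsupp.sum, map_sum, hWb]
    have h3 : ∀ᵐ ω ∂P, ∀ i ∈ a.support, (a i • X i : Lp ℝ 2 P) ω = a i * ω i := by
      rw [Finset.eventually_all]
      intro i _
      filter_upwards [Lp.coeFn_smul (a i) (X i), hXae i] with ω h4 h5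
      rw [h4, Pi.smul_apply, h5, smul_eq_mul]
    have h2 := Lp.coeFn_finsetSum a.support (fun i => a i • X i)
    rw [h1]
    filter_upwards [h2, h3] with ω h4 h5
    rw [h4, Finsupp.sum, Finset.sum_apply]
    exact Finset.sum_congr rfl h5
  have hn : ‖a.sum fun i r => r • b i‖ ^ 2 / 2 = a.sum fun _ r => r ^ 2 / 2 := by
    rw [← real_inner_self_eq_norm_sq, Finsupp.sum, b.orthonormal.inner_sum, Finsupp.sum,
      Finset.sum_div]
    simp [sq]
  simp only
  rw [hn, ← integral_exp_linearCombination a]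
  refine integral_congr_ae ?_
  filter_upwards [hae] with ω h
  rw [h]

theorem exists_isGaussianLimit [CompleteSpace E] :
    ∃ ν : Measure (AlgExt E), IsGaussianLimit ν := by
  classical
  obtain ⟨Ω, mΩ, P, hP, W, hW⟩ := exists_isonormal E
  let B := Module.Basis.ofVectorSpace ℝ (StrongDual ℝ E)
  let G : StrongDual ℝ E →ₗ[ℝ] Lp ℝ 2 P := (Real.sqrt 2)⁻¹ •
    (W ∘ₗ (InnerProductSpace.toDual ℝ E).symm.toLinearEquiv.toLinearMap)
  let Y : Ω → AlgExt E := fun ω => B.constr ℝ fun i => G (B i) ω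
  have hYe : ∀ l ω, Y ω l = (B.repr l).sum fun i r => r * G (B i) ω := by
    intro l ω
    simp [Y, Module.Basis.constr_apply]
  have hYm : Measurable Y := by
    refine measurable_comap_iff.2 (measurable_pi_lambda _ fun l => ?_)
    change Measurable fun ω => Y ω l
    simp_rw [hYe, Finsupp.sum]
    exact Finset.measurable_sum _ fun i _ =>
      (Lp.stronglyMeasurable (G (B i))).measurable.const_mul _
  have hYae : ∀ l, ∀ᵐ ω ∂P, Y ω l = G l ω := by
    intro l
    have h1 : G l = ∑ i ∈ (B.repr l).support, (B.repr l) i • G (B i) := by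
      conv_lhs => rw [← B.linearCombination_repr l]
      simp [Finsupp.linearCombination_apply, Finsupp.sum, map_sum]
    have h3 : ∀ᵐ ω ∂P, ∀ i ∈ (B.repr l).support,
        ((B.repr l) i • G (B i) : Lp ℝ 2 P) ω = (B.repr l) i * G (B i) ω := by
      rw [Finset.eventually_all]
      intro i _
      filter_upwards [Lp.coeFn_smul ((B.repr l) i) (G (B i))] with ω h4
      rw [h4, Pi.smul_apply, smul_eq_mul]
    have h2 := Lp.coeFn_finsetSum (B.repr l).support (fun i => (B.repr l) i • G (B i))
    rw [h1]
    filter_upwards [h2, h3] with ω h4 h5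
    rw [h4, hYe, Finsupp.sum, Finset.sum_apply]
    exact (Finset.sum_congr rfl h5).symm
  have : IsProbabilityMeasure (P.map Y) := Measure.isProbabilityMeasure_map hYm.aemeasurable
  refine ⟨P.map Y, isGaussianLimit_of_charFun fun v => ?_⟩
  have hm := measurable_algExt_apply (innerSL ℝ v)
  rw [integral_map hYm.aemeasurable
    (by exact (by fun_prop : Measurable fun t : ℝ =>
      Complex.exp ((t : ℂ) * Complex.I)).comp hm |>.aestronglyMeasurable)]
  have hG : G (innerSL ℝ v) = W ((Real.sqrt 2)⁻¹ • v) := by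
    have : (InnerProductSpace.toDual ℝ E).symm (innerSL ℝ v) = v :=
      (InnerProductSpace.toDual ℝ E).symm_apply_apply v
    simp [G, this]
  have h1 : ∫ ω, Complex.exp (((Y ω (innerSL ℝ v) : ℝ) : ℂ) * Complex.I) ∂P =
      ∫ ω, Complex.exp (((W ((Real.sqrt 2)⁻¹ • v) ω : ℝ) : ℂ) * Complex.I) ∂P := by
    refine integral_congr_ae ?_
    filter_upwards [hYae (innerSL ℝ v)] with ω h
    rw [h, hG]
  rw [h1, hW, norm_smul, mul_pow]
  congr 3
  rw [norm_inv, inv_pow, Real.norm_eq_abs, sq_abs, Real.sq_sqrt (by norm_num)]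
  ring

variable (E) in
/-- The Gaussian measure on the extension of `E`; it is the unique measure with the finite-dimensional
projections demanded by `IsGaussianLimit`, see `IsGaussianLimit.unique`. -/
def gaussianExt [CompleteSpace E] : Measure (AlgExt E) :=
  Classical.choose (exists_isGaussianLimit (E := E))

theorem isGaussianLimit_gaussianExt [CompleteSpace E] : IsGaussianLimit (gaussianExt E) :=
  Classical.choose_spec exists_isGaussianLimit

end GaussianExtension

/-! ## Affine field theory -/

/-- The momentum subspace `M = {τ | [ξ, τ] = 0 for all ξ}` of a bilinear form `[·, ·]`. -/
def momentumSpace {L : Type*} [AddCommGroup L] [Module ℝ L] (b : L →ₗ[ℝ] L →ₗ[ℝ] ℝ) :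
    Submodule ℝ L where
  carrier := {τ | ∀ ξ, b ξ τ = 0}
  add_mem' h h' ξ := by rw [map_add, h ξ, h' ξ, add_zero]
  zero_mem' ξ := map_zero _
  smul_mem' r τ h ξ := by rw [map_smul, h ξ, smul_zero]

/-- The subspace `N = {τ | [τ, ξ] = 0 for all ξ}` of a bilinear form `[·, ·]`. -/
def complementSpace {L : Type*} [AddCommGroup L] [Module ℝ L] (b : L →ₗ[ℝ] L →ₗ[ℝ] ℝ) :
    Submodule ℝ L where
  carrier := {τ | ∀ ξ, b τ ξ = 0}
  add_mem' h h' ξ := by rw [map_add, LinearMap.add_apply, h ξ, h' ξ, add_zero]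
  zero_mem' ξ := by rw [map_zero, LinearMap.zero_apply]
  smul_mem' r τ h ξ := by rw [map_smul, LinearMap.smul_apply, h ξ, smul_zero]

/-- The data of an affine field theory: the space of solutions `A`, an affine space over the real
vector space `L`, with a translation-equivariant symplectic potential `θ` that is adapted to the
Schrödinger polarization `M` and whose symplectic form is non-degenerate. -/
structure AffineFieldTheory (L A : Type*) [AddCommGroup L] [Module ℝ L] [AddTorsor L A] where
  /-- the symplectic potential -/
  θ : A → L →ₗ[ℝ] ℝ
  /-- the bilinear form `[·, ·]` -/
  br : L →ₗ[ℝ] L →ₗ[ℝ] ℝ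
  equivariant : ∀ (η : A) (ξ τ : L), θ (ξ +ᵥ η) τ = θ η τ + br ξ τ
  nondegenerate : ∀ ξ : L,
    (∀ τ : L, (1 / 2 : ℝ) * br ξ τ - (1 / 2 : ℝ) * br τ ξ = 0) → ξ = 0
  span_eq_top : momentumSpace br ⊔ complementSpace br = ⊤
  adapted : ∀ (η : A), ∀ τ ∈ momentumSpace br, θ η τ = 0

namespace AffineFieldTheory

variable {L A : Type*} [AddCommGroup L] [Module ℝ L] [AddTorsor L A]
variable (T : AffineFieldTheory L A)

/-- The momentum subspace `M`. -/
abbrev M : Submodule ℝ L := momentumSpace T.br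

/-- The linear space `Q = L / M` over which the space of field configurations is affine. -/
abbrev Q : Type _ := L ⧸ T.M

/-- The quotient map `q : L → Q`. -/
abbrev q : L →ₗ[ℝ] T.Q := T.M.mkQ

/-- The form `[·, ·]` viewed as a map `L × Q → ℝ`. -/
def brQ (ξ : L) : T.Q →ₗ[ℝ] ℝ := T.M.liftQ (T.br ξ) fun _ h => h ξ

/-- Two solutions are equivalent if they differ by an element of `M`. -/
def configSetoid : Setoid A where
  r ζ ζ' := ζ -ᵥ ζ' ∈ T.M
  iseqv :=
    { refl := fun ζ => by rw [vsub_self]; exact zero_mem _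
      symm := fun {ζ ζ'} h => by rw [← neg_vsub_eq_vsub_rev]; exact neg_mem h
      trans := fun {ζ ζ' ζ''} h h' => by
        rw [← vsub_add_vsub_cancel ζ ζ' ζ'']; exact add_mem h h' }

/-- The space `C = A / M` of field configurations. -/
def C : Type _ := Quotient T.configSetoid

/-- The quotient map `c : A → C`. -/
def c (ζ : A) : T.C := Quotient.mk T.configSetoid ζ

/-- A symmetric bilinear form `Ω : Q × Q → ℂ` with positive definite real part. -/
structure PositiveForm where
  /-- the form -/
  Ω : T.Q →ₗ[ℝ] T.Q →ₗ[ℝ] ℂ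
  symm : ∀ φ φ', Ω φ φ' = Ω φ' φ
  pos : ∀ φ, φ ≠ 0 → 0 < (Ω φ φ).re

variable {T}

/-- The space `Q` as an inner product space, with the inner product `Re Ω`. -/
def PositiveForm.Space (_ : T.PositiveForm) : Type _ := T.Q

namespace PositiveForm

variable (V : T.PositiveForm)

/-- The inner product `Re Ω` on `Q`. -/
@[reducible] def core : InnerProductSpace.Core ℝ T.Q where
  inner φ φ' := (V.Ω φ φ').re
  conj_inner_symm φ φ' := by rw [V.symm φ φ']; rfl
  re_inner_nonneg φ := by
    rcases eq_or_ne φ 0 with rfl | h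
    · simp
    · exact (V.pos φ h).le
  add_left φ φ' φ'' := by simp
  smul_left φ φ' r := by simp
  definite φ h := by
    by_contra h0
    exact (V.pos φ h0).ne' h

instance : NormedAddCommGroup V.Space :=
  letI := V.core
  InnerProductSpace.Core.toNormedAddCommGroup (𝕜 := ℝ) (F := T.Q)

instance : InnerProductSpace ℝ V.Space :=
  InnerProductSpace.ofCore V.core.toCore

/-- The identity map from `Q` to `Q` equipped with the inner product `Re Ω`. -/
def toSpace : T.Q ≃ₗ[ℝ] V.Space where
  toFun φ := φ
  invFun φ := φ
  map_add' _ _ := rfl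
  map_smul' _ _ := rfl
  left_inv _ := rfl
  right_inv _ := rfl

lemma inner_toSpace (φ φ' : T.Q) :
    inner ℝ (V.toSpace φ) (V.toSpace φ') = (V.Ω φ φ').re := rfl

end PositiveForm

variable (T)

/-- An admissible form: `Q` is a separable Hilbert space for `Re Ω`, the imaginary part of `Ω` is
continuous for this topology, and the continuous linear functionals on `Q` are exactly the maps
`φ ↦ [ξ, φ]` with `ξ ∈ L`. -/
structure AdmissibleForm extends T.PositiveForm where
  complete : CompleteSpace toPositiveForm.Space
  separable : TopologicalSpace.SeparableSpace toPositiveForm.Space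
  continuous_im : Continuous fun p : toPositiveForm.Space × toPositiveForm.Space =>
    (Ω (toPositiveForm.toSpace.symm p.1) (toPositiveForm.toSpace.symm p.2)).im
  continuous_br : ∀ ξ : L, Continuous fun φ : toPositiveForm.Space =>
    T.brQ ξ (toPositiveForm.toSpace.symm φ)
  exists_br : ∀ f : StrongDual ℝ toPositiveForm.Space, ∃ ξ : L, ∀ φ : T.Q,
    f (toPositiveForm.toSpace φ) = T.brQ ξ φ

namespace AdmissibleForm

variable {T}
variable (V : T.AdmissibleForm)

/-- The real Hilbert space `Q`, with inner product `Re Ω`. -/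
abbrev Space : Type _ := V.toPositiveForm.Space

instance : CompleteSpace V.Space := V.complete

instance : TopologicalSpace.SeparableSpace V.Space := V.separable

/-- The extension `Q̂` of `Q`, the algebraic dual of the topological dual. -/
abbrev Qhat : Type _ := AlgExt V.Space

/-- The inclusion of `Q` into `Q̂`. -/
def incl (φ : T.Q) : V.Qhat := AlgExt.incl (V.toSpace φ)

/-- The Gaussian measure `ν_Q` on `Q̂`. -/
def ν : Measure V.Qhat := gaussianExt V.Space

/-- The continuous functional `φ ↦ [ξ, φ]` on `Q`. -/
def brDual (ξ : L) : StrongDual ℝ V.Space where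
  toLinearMap := T.brQ ξ ∘ₗ V.toSpace.symm.toLinearMap
  cont := V.continuous_br ξ

/-- The continuous functional `φ ↦ Re (Ω (σ, φ))` on `Q`. -/
def reDual (σ : T.Q) : StrongDual ℝ V.Space := innerSL ℝ (V.toSpace σ)

/-- The continuous functional `φ ↦ Im (Ω (σ, φ))` on `Q`. -/
def imDual (σ : T.Q) : StrongDual ℝ V.Space where
  toLinearMap := Complex.imLm ∘ₗ V.Ω σ ∘ₗ V.toSpace.symm.toLinearMap
  cont := V.continuous_im.comp (Continuous.prodMk_right (V.toSpace σ))

/-- The canonical extension to `Q̂` of the functional `φ ↦ Ω (σ, φ)` on `Q`. -/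
def ΩHat (σ : T.Q) (x : V.Qhat) : ℂ :=
  ((x (V.reDual σ) : ℝ) : ℂ) + Complex.I * ((x (V.imDual σ) : ℝ) : ℂ)

/-- The Schrödinger wave function on `C` of the affine coherent state associated to `η ∈ A`, namely
`exp (i θ(η, φ - c(η)) - Ω(φ - c(η), φ - c(η)) / 2)`. -/
def coherentWave (η : A) : T.C → ℂ :=
  Quotient.lift (fun ζ : A => Complex.exp (Complex.I * ((T.θ η (ζ -ᵥ η) : ℝ) : ℂ)
    - 1 / 2 * V.Ω (T.q (ζ -ᵥ η)) (T.q (ζ -ᵥ η)))) fun ζ ζ' h => by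
    have h : ζ -ᵥ ζ' ∈ T.M := h
    have hv : ζ -ᵥ η = (ζ -ᵥ ζ') + (ζ' -ᵥ η) := (vsub_add_vsub_cancel ζ ζ' η).symm
    have hq : T.q (ζ -ᵥ ζ') = 0 := (Submodule.Quotient.mk_eq_zero _).2 h
    simp only [hv, map_add, hq, zero_add, T.adapted η _ h]

/-- The `η'`-reduced wave function of the affine coherent state associated to `η ∈ A`, as a function
on `Q̂`. Its restriction to `Q` is the quotient of the wave functions of the coherent states of `η`
and of `η'`, translated by `c(η')`, see `reducedCoherent_incl`. -/
def reducedCoherent (η η' : A) (x : V.Qhat) : ℂ :=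
  Complex.exp (Complex.I * ((T.θ η (η' -ᵥ η) : ℝ) : ℂ)
    - 1 / 2 * V.Ω (T.q (η' -ᵥ η)) (T.q (η' -ᵥ η))
    - Complex.I * ((x (V.brDual (η' -ᵥ η)) : ℝ) : ℂ)
    - V.ΩHat (T.q (η' -ᵥ η)) x)

lemma ΩHat_incl (σ φ : T.Q) : V.ΩHat σ (V.incl φ) = V.Ω σ φ := by
  have h : V.ΩHat σ (V.incl φ) =
      (((V.Ω σ φ).re : ℝ) : ℂ) + Complex.I * (((V.Ω σ φ).im : ℝ) : ℂ) := rfl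
  rw [h, mul_comm, Complex.re_add_im]

/-- The reduced wave function, evaluated at `φ = q(ζ - η')`, i.e. at `φ + c(η') = c(ζ)`, is
the quotient of the coherent wave functions on `C`. -/
theorem reducedCoherent_incl (η η' ζ : A) :
    V.reducedCoherent η η' (V.incl (T.q (ζ -ᵥ η'))) =
      V.coherentWave η (T.c ζ) / V.coherentWave η' (T.c ζ) := by
  have h1 : V.incl (T.q (ζ -ᵥ η')) (V.brDual (η' -ᵥ η)) = T.br (η' -ᵥ η) (ζ -ᵥ η') := rfl
  have hc : ∀ ξ : A, V.coherentWave ξ (T.c ζ) =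
      Complex.exp (Complex.I * ((T.θ ξ (ζ -ᵥ ξ) : ℝ) : ℂ)
        - 1 / 2 * V.Ω (T.q (ζ -ᵥ ξ)) (T.q (ζ -ᵥ ξ))) := fun _ => rfl
  have hθ : T.θ η' (ζ -ᵥ η') = T.θ η (ζ -ᵥ η') + T.br (η' -ᵥ η) (ζ -ᵥ η') := by
    rw [← T.equivariant, vsub_vadd]
  have hv : ζ -ᵥ η = (η' -ᵥ η) + (ζ -ᵥ η') := by
    rw [add_comm, vsub_add_vsub_cancel]
  rw [hc, hc, ← Complex.exp_sub, reducedCoherent, ΩHat_incl, h1, hθ, hv]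
  congr 1
  simp only [map_add, LinearMap.add_apply, V.symm (T.q (ζ -ᵥ η')) (T.q (η' -ᵥ η)),
    Complex.ofReal_add]
  ring

/-- Reduced wave functions with respect to different base points `η'`, `η''` are related by
`ψ''(φ) = ψ'(φ + q(η'' - η')) β(φ)`, where `β` is the `η''`-reduced wave function of the coherent
state of `η'`. The reduced wave functions of a coherent state are compatible with this. -/
theorem reducedCoherent_base_change (η η' η'' : A) (x : V.Qhat) :
    V.reducedCoherent η η'' x =
      V.reducedCoherent η η' (x + V.incl (T.q (η'' -ᵥ η'))) * V.reducedCoherent η' η'' x := by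
  have hbr : ∀ a b : L, V.brDual (a + b) = V.brDual a + V.brDual b := by
    intro a b
    ext φ
    obtain ⟨φ, rfl⟩ := V.toSpace.surjective φ
    obtain ⟨ξ, rfl⟩ := T.M.mkQ_surjective φ
    change T.br (a + b) ξ = T.br a ξ + T.br b ξ
    rw [map_add, LinearMap.add_apply]
  have hre : ∀ a b : T.Q, V.reDual (a + b) = V.reDual a + V.reDual b := by
    intro a b
    rw [reDual, map_add, map_add]
    rfl
  have him : ∀ a b : T.Q, V.imDual (a + b) = V.imDual a + V.imDual b := by
    intro a b
    ext φ
    obtain ⟨φ, rfl⟩ := V.toSpace.surjective φ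
    change (V.Ω (a + b) φ).im = (V.Ω a φ).im + (V.Ω b φ).im
    rw [map_add, LinearMap.add_apply, Complex.add_im]
  have hΩ : ∀ (a b : T.Q) (y : V.Qhat), V.ΩHat (a + b) y = V.ΩHat a y + V.ΩHat b y := by
    intro a b y
    simp only [ΩHat, hre, him, map_add, Complex.ofReal_add]
    ring
  have hΩ' : ∀ (a : T.Q) (y z : V.Qhat), V.ΩHat a (y + z) = V.ΩHat a y + V.ΩHat a z := by
    intro a y z
    simp only [ΩHat, LinearMap.add_apply, Complex.ofReal_add]
    ring
  have hv : η'' -ᵥ η = (η' -ᵥ η) + (η'' -ᵥ η') := by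
    rw [add_comm, vsub_add_vsub_cancel]
  have hθ : T.θ η' (η'' -ᵥ η') = T.θ η (η'' -ᵥ η') + T.br (η' -ᵥ η) (η'' -ᵥ η') := by
    rw [← T.equivariant, vsub_vadd]
  have h1 : V.incl (T.q (η'' -ᵥ η')) (V.brDual (η' -ᵥ η)) = T.br (η' -ᵥ η) (η'' -ᵥ η') := rfl
  rw [reducedCoherent, reducedCoherent, reducedCoherent, ← Complex.exp_add, hθ, hv]
  congr 1
  simp only [map_add, LinearMap.add_apply, V.symm (T.q (η'' -ᵥ η')) (T.q (η' -ᵥ η)),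
    Complex.ofReal_add, hbr, hΩ, hΩ', ΩHat_incl, h1]
  ring

/-- The subspace of `L²(Q̂, ν_Q)` spanned by the coherent states, in the presentation of states by
`η'`-reduced wave functions. -/
def coherentSubspace (η' : A) : Submodule ℂ (Lp ℂ 2 V.ν) :=
  Submodule.span ℂ {f | ∃ η : A, f =ᵐ[V.ν] V.reducedCoherent η η'}

end AdmissibleForm

end AffineFieldTheory

end SchrodingerRep

end

/-! The coherent states displaced from the base point along the momentum space `M` are, in reduced
form, exactly the characters `exp (i x(l))` of `Q̂`: their displacement vanishes in `Q`, which kills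
every `Ω`-term, adaptedness kills the `θ`-term, and `M + N = L` together with the admissibility of
`Ω` makes every continuous functional `l` on `Q` of the form `[m, ·]` with `m ∈ M`. A function
orthogonal to all characters has vanishing Fourier transform, and is therefore zero because a finite
measure on `Q̂` is determined by its Fourier transform. -/

namespace SchrodingerRep

section Fourier

variable {F : Type*} [AddCommGroup F] [Module ℝ F]

/-- The character `x ↦ exp (i x(l))` of the algebraic dual of `F` associated to `l : F`. -/
noncomputable def character (l : F) (x : Module.Dual ℝ F) : ℂ :=
  Complex.exp (((x l : ℝ) : ℂ) * Complex.I)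

lemma norm_character (l : F) (x : Module.Dual ℝ F) : ‖character l x‖ = 1 :=
  Complex.norm_exp_ofReal_mul_I _

lemma conj_character (l : F) (x : Module.Dual ℝ F) :
    starRingEnd ℂ (character l x) = character (-l) x := by
  simp [character, ← Complex.exp_conj]

variable {α : Type*} [mα : MeasurableSpace α] {X : α → Module.Dual ℝ F} {μ μ' : Measure α}

lemma measurable_character_comp {l : F} (hl : Measurable fun a => X a l) :
    Measurable fun a => character l (X a) :=
  (by fun_prop : Measurable fun t : ℝ => Complex.exp ((t : ℂ) * Complex.I)).comp hl

lemma integrable_character_mul {l : F} (hl : Measurable fun a => X a l) {f : α → ℂ}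
    (hf : Integrable f μ) : Integrable (fun a => character l (X a) * f a) μ :=
  hf.bdd_mul (c := 1) (measurable_character_comp hl).aestronglyMeasurable
    (ae_of_all _ fun a => (norm_character l (X a)).le)

lemma map_coordinates_eq_of_integral_character_eq [IsFiniteMeasure μ] [IsFiniteMeasure μ']
    {ι : Type*} [Finite ι] (v : ι → F) (hX : ∀ i, Measurable fun a => X a (v i))
    (h : ∀ l, ∫ a, character l (X a) ∂μ = ∫ a, character l (X a) ∂μ') :
    μ.map (fun a i => X a (v i)) = μ'.map (fun a i => X a (v i)) := by
  classical
  cases nonempty_fintype ι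
  have hm : Measurable fun a i => X a (v i) := measurable_pi_lambda _ hX
  refine Measure.ext_of_charFunDual (funext fun L => ?_)
  have coordinates_pairing (a : α) :
      L (fun i => X a (v i)) = X a (∑ i, L (fun j => if i = j then 1 else 0) • v i) := by
    rw [← ContinuousLinearMap.coe_coe, LinearMap.pi_apply_eq_sum_univ]
    simp [mul_comm]
  rw [charFunDual_apply, charFunDual_apply, integral_map hm.aemeasurable (by fun_prop),
    integral_map hm.aemeasurable (by fun_prop)]
  simp_rw [coordinates_pairing]
  exact h _

/-- The `σ`-algebra of `α` is the smallest one for which all the coordinates `a ↦ X a l` of the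
random linear functional `X` are measurable, i.e. it consists of the preimages under `X` of the
cylinder `σ`-algebra of the algebraic dual. -/
def GeneratesSigmaAlgebra (X : α → Module.Dual ℝ F) : Prop :=
  mα = MeasurableSpace.comap (fun a (l : F) => X a l) MeasurableSpace.pi

namespace GeneratesSigmaAlgebra

lemma measurable_coordinates (hX : GeneratesSigmaAlgebra X) :
    Measurable fun a (l : F) => X a l :=
  measurable_iff_comap_le.2 hX.ge

lemma measurable_apply (hX : GeneratesSigmaAlgebra X) (l : F) : Measurable fun a => X a l :=
  (measurable_pi_apply l).comp hX.measurable_coordinates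

theorem measure_ext [IsFiniteMeasure μ] [IsFiniteMeasure μ'] (hX : GeneratesSigmaAlgebra X)
    (h : ∀ l, ∫ a, character l (X a) ∂μ = ∫ a, character l (X a) ∂μ') : μ = μ' := by
  have hm := hX.measurable_coordinates
  have map_restrict (ρ : Measure α) (J : Finset F) :
      (ρ.map fun a (l : F) => X a l).map J.restrict = ρ.map fun a (j : J) => X a j :=
    Measure.map_map (by fun_prop) hm
  have map_eq : (μ.map fun a (l : F) => X a l) = μ'.map fun a (l : F) => X a l := by
    refine IsProjectiveLimit.unique
      (P := fun J => (μ'.map fun a (l : F) => X a l).map J.restrict) (fun J => ?_) fun _ => rfl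
    calc (μ.map fun a (l : F) => X a l).map J.restrict
        = μ.map fun a (j : J) => X a j := map_restrict μ J
      _ = μ'.map fun a (j : J) => X a j :=
        map_coordinates_eq_of_integral_character_eq _ (fun j => hX.measurable_apply j) h
      _ = (μ'.map fun a (l : F) => X a l).map J.restrict := (map_restrict μ' J).symm
  ext s hs
  obtain ⟨t, ht, rfl⟩ := hX.le s hs
  simpa only [Measure.map_apply hm ht] using congrArg (· t) map_eq

end GeneratesSigmaAlgebra

lemma integral_withDensity_ofReal_sub {G : Type*} [NormedAddCommGroup G] [NormedSpace ℝ G]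
    {u : α → ℝ} {g : α → G} (hu : AEMeasurable u μ) (hg : AEStronglyMeasurable g μ)
    (hug : Integrable (fun a => u a • g a) μ) :
    ∫ a, g a ∂(μ.withDensity fun a => ENNReal.ofReal (u a)) -
      ∫ a, g a ∂(μ.withDensity fun a => ENNReal.ofReal (-u a)) = ∫ a, u a • g a ∂μ := by
  have integral_eq {w : α → ℝ} (hw : AEMeasurable w μ) :
      ∫ a, g a ∂(μ.withDensity fun a => ENNReal.ofReal (w a)) = ∫ a, max (w a) 0 • g a ∂μ := by
    simp only [integral_withDensity_eq_integral_toReal_smul₀ hw.ennreal_ofReal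
      (ae_of_all _ fun _ => ENNReal.ofReal_lt_top), ENNReal.toReal_ofReal']
  have integrable_of_le {w : α → ℝ} (hw : AEMeasurable w μ) (hwu : ∀ a, |w a| ≤ |u a|) :
      Integrable (fun a => w a • g a) μ :=
    hug.mono (hw.aestronglyMeasurable.smul hg) <| ae_of_all _ fun a => by
      rw [norm_smul, norm_smul]
      exact mul_le_mul_of_nonneg_right (hwu a) (norm_nonneg (g a))
  rw [integral_eq hu, integral_eq (w := fun a => -u a) hu.neg, ← integral_sub
    (integrable_of_le (hu.max aemeasurable_const) fun a => by
      simpa using abs_max_le_max_abs_abs (a := u a) (b := 0))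
    (integrable_of_le (w := fun a => max (-u a) 0) (hu.neg.max aemeasurable_const) fun a => by
      simpa using abs_max_le_max_abs_abs (a := -u a) (b := 0))]
  simp only [← sub_smul, max_zero_sub_eq_self]

lemma ae_eq_zero_of_withDensity_ofReal_eq {u : α → ℝ} (hu : Integrable u μ)
    (h : (μ.withDensity fun a => ENNReal.ofReal (u a)) =
      μ.withDensity fun a => ENNReal.ofReal (-u a)) : u =ᵐ[μ] 0 := by
  have ofReal_eq := (withDensity_eq_iff hu.1.aemeasurable.ennreal_ofReal
    hu.neg.1.aemeasurable.ennreal_ofReal hu.lintegral_lt_top.ne).1 h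
  filter_upwards [ofReal_eq] with a ha
  have toReal_eq := congrArg ENNReal.toReal ha
  rw [ENNReal.toReal_ofReal', ENNReal.toReal_ofReal', ← sub_eq_zero] at toReal_eq
  exact (max_zero_sub_eq_self (u a)).symm.trans toReal_eq

namespace GeneratesSigmaAlgebra

lemma ofReal_ae_eq_zero_of_integral_character_mul (hX : GeneratesSigmaAlgebra X) {u : α → ℝ}
    (hu : Integrable u μ) (h : ∀ l, ∫ a, character l (X a) * (u a : ℂ) ∂μ = 0) :
    u =ᵐ[μ] 0 := by
  have : IsFiniteMeasure (μ.withDensity fun a => ENNReal.ofReal (u a)) :=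
    isFiniteMeasure_withDensity_ofReal hu.2
  have : IsFiniteMeasure (μ.withDensity fun a => ENNReal.ofReal (-u a)) :=
    isFiniteMeasure_withDensity_ofReal hu.neg.2
  refine ae_eq_zero_of_withDensity_ofReal_eq hu (hX.measure_ext fun l => ?_)
  have smul_eq (a : α) : u a • character l (X a) = character l (X a) * (u a : ℂ) := by
    rw [Complex.real_smul, mul_comm]
  have hl := hX.measurable_apply l
  rw [← sub_eq_zero, integral_withDensity_ofReal_sub hu.1.aemeasurable
    (measurable_character_comp hl).aestronglyMeasurable]
  · simpa only [smul_eq] using h l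
  · simp only [smul_eq]
    exact integrable_character_mul hl (f := fun a => (u a : ℂ)) hu.ofReal

lemma re_ae_eq_zero_of_integral_character_mul (hX : GeneratesSigmaAlgebra X) {f : α → ℂ}
    (hf : Integrable f μ) (h : ∀ l, ∫ a, character l (X a) * f a ∂μ = 0) :
    (fun a => (f a).re) =ᵐ[μ] 0 := by
  refine hX.ofReal_ae_eq_zero_of_integral_character_mul hf.re fun l => ?_
  have character_mul_re (a : α) : character l (X a) * ((f a).re : ℂ) =
      (1 / 2) * (character l (X a) * f a + starRingEnd ℂ (character (-l) (X a) * f a)) := by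
    rw [map_mul, conj_character, neg_neg, Complex.re_eq_add_conj]
    ring
  have integrable (l : F) := integrable_character_mul (hX.measurable_apply l) hf
  have integrable_conj :
      Integrable (fun a => starRingEnd ℂ (character (-l) (X a) * f a)) μ :=
    (LinearIsometryEquiv.integrable_comp_iff Complex.conjLIE).2 (integrable (-l))
  calc ∫ a, character l (X a) * ((f a).re : ℂ) ∂μ
      = (1 / 2) * (∫ a, character l (X a) * f a ∂μ +
          starRingEnd ℂ (∫ a, character (-l) (X a) * f a ∂μ)) := by
        simp_rw [character_mul_re]
        rw [integral_const_mul, integral_add (integrable l) integrable_conj,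
          integral_conj]
    _ = 0 := by rw [h, h, map_zero, add_zero, mul_zero]

theorem ae_eq_zero_of_integral_character_mul (hX : GeneratesSigmaAlgebra X) {f : α → ℂ}
    (hf : Integrable f μ) (h : ∀ l, ∫ a, character l (X a) * f a ∂μ = 0) : f =ᵐ[μ] 0 := by
  have re_eq := hX.re_ae_eq_zero_of_integral_character_mul hf h
  have im_eq := hX.re_ae_eq_zero_of_integral_character_mul (hf.const_mul (-Complex.I)) fun l => by
    simp_rw [mul_left_comm _ (-Complex.I)]
    rw [integral_const_mul, h, mul_zero]
  filter_upwards [re_eq, im_eq] with a hre him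
  exact Complex.ext hre (by simpa using him)

theorem dense_of_character_mem [IsFiniteMeasure μ] (hX : GeneratesSigmaAlgebra X)
    {S : Submodule ℂ (Lp ℂ 2 μ)} (hS : ∀ l, ∃ g ∈ S, g =ᵐ[μ] fun a => character l (X a)) :
    Dense (S : Set (Lp ℂ 2 μ)) := by
  rw [Submodule.dense_iff_topologicalClosure_eq_top, Submodule.topologicalClosure_eq_top_iff,
    Submodule.eq_bot_iff]
  intro f hf
  rw [Lp.eq_zero_iff_ae_eq_zero]
  refine hX.ae_eq_zero_of_integral_character_mul ((Lp.memLp f).integrable one_le_two) fun l => ?_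
  obtain ⟨g, hgS, hg⟩ := hS (-l)
  calc ∫ a, character l (X a) * f a ∂μ
      = inner ℂ g f := by
        rw [L2.inner_def]
        refine integral_congr_ae ?_
        filter_upwards [hg] with a ha
        rw [ha, RCLike.inner_apply, conj_character, neg_neg, mul_comm]
    _ = 0 := (Submodule.mem_orthogonal _ _).1 hf g hgS

end GeneratesSigmaAlgebra

end Fourier

section Gaussian

variable {E : Type*} [NormedAddCommGroup E] [InnerProductSpace ℝ E]

lemma AlgExt.generatesSigmaAlgebra_id :
    GeneratesSigmaAlgebra (fun x : AlgExt E => (x : Module.Dual ℝ (StrongDual ℝ E))) :=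
  rfl

variable {ν : Measure (AlgExt E)}

lemma IsGaussianLimit.map_innerSL (h : IsGaussianLimit ν) (v : E) :
    ν.map (fun x : AlgExt E => x (innerSL ℝ v)) = gaussianReal 0 (‖v‖₊ ^ 2 / 2) := by
  have := h.isProbabilityMeasure
  have hm := measurable_algExt_apply (innerSL ℝ v)
  refine Measure.ext_of_charFun (funext fun t => ?_)
  have apply_smul (x : AlgExt E) :
      (t : ℂ) * ((x (innerSL ℝ v) : ℝ) : ℂ) = ((x (innerSL ℝ (t • v)) : ℝ) : ℂ) := by
    rw [map_smul, map_smul, smul_eq_mul, Complex.ofReal_mul]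
  rw [charFun_gaussianReal, charFun_apply_real, integral_map hm.aemeasurable (by fun_prop)]
  simp_rw [apply_smul]
  rw [h.charFun, norm_smul, mul_pow, Real.norm_eq_abs, sq_abs]
  congr 1
  push_cast
  ring

lemma IsGaussianLimit.hasSubgaussianMGF (h : IsGaussianLimit ν) (v : E) :
    HasSubgaussianMGF (fun x : AlgExt E => x (innerSL ℝ v)) (‖v‖₊ ^ 2 / 2) ν where
  integrable_exp_mul t := by
    have integrable_map := integrable_exp_mul_gaussianReal (μ := 0) (v := ‖v‖₊ ^ 2 / 2) t
    rw [← h.map_innerSL v] at integrable_map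
    exact integrable_map.comp_measurable (measurable_algExt_apply _)
  mgf_le t := by rw [mgf_gaussianReal (h.map_innerSL v), zero_mul, zero_add]

end Gaussian

namespace AffineFieldTheory.AdmissibleForm

variable {L A : Type*} [AddCommGroup L] [Module ℝ L] [AddTorsor L A]
variable {T : AffineFieldTheory L A} (V : T.AdmissibleForm)

lemma isGaussianLimit_ν : IsGaussianLimit V.ν := isGaussianLimit_gaussianExt

instance : IsProbabilityMeasure V.ν := V.isGaussianLimit_ν.isProbabilityMeasure

lemma measurable_reducedCoherent (η η' : A) : Measurable (V.reducedCoherent η η') := by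
  have hb := measurable_algExt_apply (V.brDual (η' -ᵥ η))
  have hr := measurable_algExt_apply (V.reDual (T.q (η' -ᵥ η)))
  have hi := measurable_algExt_apply (V.imDual (T.q (η' -ᵥ η)))
  exact Complex.measurable_exp.comp ((measurable_const.sub (hb.complex_ofReal.const_mul _)).sub
    (hr.complex_ofReal.add (hi.complex_ofReal.const_mul _)))

lemma norm_reducedCoherent (η η' : A) (x : V.Qhat) :
    ‖V.reducedCoherent η η' x‖ =
      Real.exp (-(1 / 2) * (V.Ω (T.q (η' -ᵥ η)) (T.q (η' -ᵥ η))).re) *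
        Real.exp (-x (V.reDual (T.q (η' -ᵥ η)))) := by
  have re_half_mul (z : ℂ) : (1 / 2 * z).re = 1 / 2 * z.re := by simp
  rw [reducedCoherent, Complex.norm_exp, ← Real.exp_add]
  congr 1
  simp only [ΩHat, re_half_mul, Complex.sub_re, Complex.add_re, Complex.I_mul_re,
    Complex.ofReal_re, Complex.ofReal_im]
  ring

theorem memLp_reducedCoherent (η η' : A) (p : NNReal) : MemLp (V.reducedCoherent η η') p V.ν := by
  have memLp_exp := (V.isGaussianLimit_ν.hasSubgaussianMGF
    (V.toSpace (T.q (η' -ᵥ η)))).memLp_exp_mul (-1) p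
  simp only [neg_one_mul] at memLp_exp
  refine (memLp_exp.const_mul
    (Real.exp (-(1 / 2) * (V.Ω (T.q (η' -ᵥ η)) (T.q (η' -ᵥ η))).re))).of_le
    (V.measurable_reducedCoherent η η').aestronglyMeasurable (ae_of_all _ fun x => ?_)
  exact (V.norm_reducedCoherent η η' x).le.trans (le_abs_self _)

lemma exists_mem_M_brDual_eq (l : StrongDual ℝ V.Space) : ∃ m ∈ T.M, V.brDual m = l := by
  obtain ⟨ξ, hξ⟩ := V.exists_br l
  obtain ⟨m, hm, n, hn, rfl⟩ := Submodule.mem_sup.1 (T.span_eq_top ▸ Submodule.mem_top (x := ξ))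
  refine ⟨m, hm, ContinuousLinearMap.ext fun φ => ?_⟩
  obtain ⟨φ, rfl⟩ := V.toSpace.surjective φ
  obtain ⟨τ, rfl⟩ := T.M.mkQ_surjective φ
  calc T.br m τ
      = T.br (m + n) τ := by rw [map_add, LinearMap.add_apply, hn τ, add_zero]
    _ = l (V.toSpace (T.q τ)) := (hξ (T.q τ)).symm

lemma ΩHat_zero (x : V.Qhat) : V.ΩHat 0 x = 0 := by
  have reDual_zero : V.reDual 0 = 0 := by rw [reDual, map_zero, map_zero]
  have imDual_zero : V.imDual 0 = 0 := by
    ext φ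
    simp [imDual]
  simp [ΩHat, reDual_zero, imDual_zero]

lemma reducedCoherent_eq_character {η η' : A} (h : η' -ᵥ η ∈ T.M) (x : V.Qhat) :
    V.reducedCoherent η η' x = character (-V.brDual (η' -ᵥ η)) x := by
  have q_eq_zero : T.q (η' -ᵥ η) = 0 := (Submodule.Quotient.mk_eq_zero _).2 h
  rw [reducedCoherent, q_eq_zero, T.adapted η _ h, ΩHat_zero, character]
  congr 1
  simp [mul_comm]

lemma exists_reducedCoherent_eq_character (η' : A) (l : StrongDual ℝ V.Space) :
    ∃ η : A, ∀ x, V.reducedCoherent η η' x = character l x := by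
  obtain ⟨m, hm, hl⟩ := V.exists_mem_M_brDual_eq (-l)
  have vsub_eq : η' -ᵥ (-m +ᵥ η') = m := by rw [vsub_vadd_eq_vsub_sub, vsub_self, zero_sub, neg_neg]
  refine ⟨-m +ᵥ η', fun x => ?_⟩
  rw [V.reducedCoherent_eq_character (vsub_eq.symm ▸ hm), vsub_eq, hl, neg_neg]

theorem dense_coherentSubspace (η' : A) :
    Dense (V.coherentSubspace η' : Set (Lp ℂ 2 V.ν)) := by
  refine AlgExt.generatesSigmaAlgebra_id.dense_of_character_mem fun l => ?_
  obtain ⟨η, hη⟩ := V.exists_reducedCoherent_eq_character η' l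
  have coeFn_toLp := (V.memLp_reducedCoherent η η' 2).coeFn_toLp
  exact ⟨_, Submodule.subset_span ⟨η, coeFn_toLp⟩, coeFn_toLp.trans (ae_of_all _ hη)⟩

end AffineFieldTheory.AdmissibleForm

end SchrodingerRep

theorem mainTheorem11 {L A : Type*} [AddCommGroup L] [Module ℝ L] [AddTorsor L A]
    (T : SchrodingerRep.AffineFieldTheory L A) (V : T.AdmissibleForm) (η' : A) :
    (∀ η : A, MeasureTheory.MemLp (V.reducedCoherent η η') 2 V.ν) ∧
      Dense (V.coherentSubspace η' : Set (MeasureTheory.Lp ℂ 2 V.ν)) :=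
  ⟨fun η => V.memLp_reducedCoherent η η' 2, V.dense_coherentSubspace η'⟩
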